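/- Let $b_1,b_2,b_3$ be any three distinct states among the four two-qubit Bell states $\phi^{\pm}=\frac{1}{\sqrt2}(|00\rangle\pm|11\rangle)$, $\psi^{\pm}=\frac{1}{\sqrt2}(|01\rangle\pm|10\rangle)$, shared between Alice (first qubit) and Bob (second qubit). A one-way LOCC protocol is one in which one of the two parties performs a quantum measurement (a POVM with finitely many outcomes) on all systems it holds and sends the outcome to the other party, who then performs a POVM, depending on the message, on its own systems and reads the answer off its outcome; the communication may go either from Alice to Bob or from Bob to Alice. Then the three Bell states cannot be perfectly marked under one-way LOCC: no one-way LOCC protocol, when Alice and Bob are given the three states in an unknown order, i.e. the state $b_{\sigma(1)}\otimes b_{\sigma(2)}\otimes b_{\sigma(3)}$ with unknown $\sigma\in S_3$, outputs $(\sigma(1),\sigma(2),\sigma(3))$ with probability $1$ for every $\sigma\in S_3$. Equivalently, the six states $\phi_\sigma=b_{\sigma(1)}\otimes b_{\sigma(2)}\otimes b_{\sigma(3)}$, $\sigma\in S_3$, regarded as states of $\mathbb{C}^8\otimes\mathbb{C}^8$ (Alice's three qubits and Bob's three qubits), are not perfectly distinguishable under one-way LOCC. Moreover, these six states are maximally entangled,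 $\phi_\sigma=(U_\sigma\otimes\mathbb{I}_8)\,\frac{1}{\sqrt8}\sum_{i=0}^{7}|i\rangle\otimes|i\rangle$ with $8\times 8$ unitary matrices $U_\sigma$, and there is no $\psi\in\mathbb{C}^8$ such that $\langle U_\sigma\psi,U_\tau\psi\rangle=\delta_{\sigma\tau}$ for all $\sigma,\tau\in S_3$. -/

import Mathlib

open scoped Matrix Kronecker ComplexOrder

/-- A quantum measurement (POVM) on the system `ℂ^d` with outcomes in the finite set `X`. -/
structure POVM (d X : Type) [Fintype d] [DecidableEq d] [Fintype X] where
  effect : X → Matrix d d ℂ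
  posSemidef : ∀ x, (effect x).PosSemidef
  sum_eq_one : ∑ x, effect x = 1

/-- A protocol with one-way classical communication on `ℂ^dA ⊗ ℂ^dB`, producing an answer in `Y`:
the first party measures and announces the outcome (one of finitely many messages), and the second
party then makes a measurement that depends on the message and whose outcome is the answer.
(Local and shared randomness, and classical post-processing, are absorbed in the POVMs.) -/
structure OneWayProtocol (dA dB Y : Type) [Fintype dA] [DecidableEq dA]
    [Fintype dB] [DecidableEq dB] [Fintype Y] where
  messages : ℕ
  sender : POVM dA (Fin messages)
  receiver : Fin messages → POVM dB Y

/-- The Born-rule probability that the protocol answers `y` on the shared pure state `ψ`, i.e.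
`∑ₓ ⟨ψ| Mₓ ⊗ N⁽ˣ⁾_y |ψ⟩`. -/
noncomputable def OneWayProtocol.prob {dA dB Y : Type} [Fintype dA] [DecidableEq dA]
    [Fintype dB] [DecidableEq dB] [Fintype Y] (P : OneWayProtocol dA dB Y)
    (ψ : dA × dB → ℂ) (y : Y) : ℝ :=
  (∑ x, star ψ ⬝ᵥ ((P.sender.effect x ⊗ₖ (P.receiver x).effect y) *ᵥ ψ)).re

/-- Some one-way LOCC protocol (the communication goes either from Alice to Bob or from Bob to
Alice) answers `label i` with certainty whenever the shared state is `φ i`. -/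
def OneWayIdentifies {dA dB I Y : Type} [Fintype dA] [DecidableEq dA]
    [Fintype dB] [DecidableEq dB] [Fintype Y] (φ : I → (dA × dB → ℂ)) (label : I → Y) : Prop :=
  (∃ P : OneWayProtocol dA dB Y, ∀ i, P.prob (φ i) (label i) = 1) ∨
  (∃ P : OneWayProtocol dB dA Y, ∀ i, P.prob (φ i ∘ Prod.swap) (label i) = 1)

/-- Perfect distinguishability of a finite family of bipartite states under one-way LOCC. -/
def OneWayDistinguishable {dA dB I : Type} [Fintype dA] [DecidableEq dA]
    [Fintype dB] [DecidableEq dB] [Fintype I] (φ : I → (dA × dB → ℂ)) : Prop :=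
  OneWayIdentifies φ (fun i => i)

/-- The state `S (j 0) ⊗ ⋯ ⊗ S (j (m-1))` of `m` bipartite systems, seen as a bipartite state
between Alice, who holds the first part of each system, and Bob, who holds the second parts. -/
def jointState {dA dB K : Type} {m : ℕ} (S : K → (dA × dB → ℂ)) (j : Fin m → K) :
    (Fin m → dA) × (Fin m → dB) → ℂ :=
  fun p => ∏ l, S (j l) (p.1 l, p.2 l)

/-- Perfect local marking of `m` states under one-way LOCC: for every choice of `m` distinct
members `S (j 0), …, S (j (m-1))` of the family, handed out in this order, the protocol outputs
their identities `(j 0, …, j (m-1))` with certainty. -/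
def OneWayMarkable {dA dB K : Type} [Fintype dA] [DecidableEq dA]
    [Fintype dB] [DecidableEq dB] [Fintype K] (m : ℕ) (S : K → (dA × dB → ℂ)) : Prop :=
  OneWayIdentifies (fun j : Fin m ↪ K => jointState S j) (fun j => (j : Fin m → K))

/-- The product state `|i⟩ ⊗ |j⟩` of two qubits. -/
def ket (i j : Fin 2) : Fin 2 × Fin 2 → ℂ := Pi.single (i, j) 1

/-- The four Bell states `φ⁺, φ⁻, ψ⁺, ψ⁻`. -/
noncomputable def bellState : Fin 4 → (Fin 2 × Fin 2 → ℂ) :=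
  ![((1 / √2 : ℝ) : ℂ) • (ket 0 0 + ket 1 1),
    ((1 / √2 : ℝ) : ℂ) • (ket 0 0 - ket 1 1),
    ((1 / √2 : ℝ) : ℂ) • (ket 0 1 + ket 1 0),
    ((1 / √2 : ℝ) : ℂ) • (ket 0 1 - ket 1 0)]

/-- The standard maximally entangled state `(1/√|d|) ∑ᵢ |i⟩ ⊗ |i⟩` of `ℂ^d ⊗ ℂ^d`. -/
noncomputable def maxEntangled (d : Type) [Fintype d] [DecidableEq d] : d × d → ℂ :=
  fun p => if p.1 = p.2 then ((1 / √(Fintype.card d : ℝ) : ℝ) : ℂ) else 0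

/-! Up to the factor `1/√8`, the state indexed by σ has as coefficient matrix a real Pauli string,
the unitary `pauliString (b ∘ σ)`. By `OneWayProtocol.exists_orthogonal_of_prob_eq_one`, a perfect
one-way protocol yields a nonzero `v` that these strings (or their transposes) send to orthogonal
vectors, so `⟨v, P v⟩ = 0` for each product `P` of the adjoint of one string with another. Label
Paulis by `𝔽₂²`, so that products become xor up to sign. By `exists_perm_xor_perm` those `P` realise
all 15 nontrivial labels `(j, k, j + k)`. With the identity they form a group of order 16 modulo
signs, so its orbit of `v` is 16 nonzero orthogonal vectors in `ℂ⁸`, which is absurd. -/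

/-! ### From protocols to orthogonal vectors. -/

open Matrix in
/-- If a one-way protocol identifies the states `φ i` by distinct labels, then some nonzero
(unnormalised) outcome vector of the sender leaves the receiver with orthogonal states. -/
theorem OneWayProtocol.exists_orthogonal_of_prob_eq_one {dA dB I Y : Type}
    [Fintype dA] [DecidableEq dA] [Nonempty dA] [Fintype dB] [DecidableEq dB] [Fintype Y]
    (P : OneWayProtocol dA dB Y)
    {φ : I → (dA × dB → ℂ)} {label : I → Y} (hlabel : Function.Injective label)
    (hφ : ∀ i, star (φ i) ⬝ᵥ φ i = 1) (hP : ∀ i, P.prob (φ i) (label i) = 1) :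
    ∃ v : dA → ℂ, v ≠ 0 ∧ ∀ i j, i ≠ j →
      star ((of fun a c => φ i (a, c))ᵀ *ᵥ v) ⬝ᵥ ((of fun a c => φ j (a, c))ᵀ *ᵥ v) = 0 := by
  classical
  have hpos : ∀ x y, (P.sender.effect x ⊗ₖ (P.receiver x).effect y).PosSemidef := fun x y =>
    (P.sender.posSemidef x).kronecker ((P.receiver x).posSemidef y)
  have htotal : ∀ i, ∑ y, P.prob (φ i) y = 1 := by
    intro i
    have hsum : ∑ y, ∑ x, P.sender.effect x ⊗ₖ (P.receiver x).effect y = 1 := by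
      rw [Finset.sum_comm]
      have hx : ∀ x, ∑ y, P.sender.effect x ⊗ₖ (P.receiver x).effect y
          = P.sender.effect x ⊗ₖ (1 : Matrix dB dB ℂ) := by
        intro x
        rw [← (P.receiver x).sum_eq_one]
        ext p q
        simp [Matrix.sum_apply, kroneckerMap_apply, Finset.mul_sum]
      simp_rw [hx]
      rw [← one_kronecker_one, ← P.sender.sum_eq_one]
      ext p q
      simp [Matrix.sum_apply, kroneckerMap_apply, Finset.sum_mul]
    simp only [OneWayProtocol.prob, ← Complex.re_sum]
    simp only [← dotProduct_sum, ← Matrix.sum_mulVec]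
    rw [hsum, one_mulVec, hφ, Complex.one_re]
  have hnonneg : ∀ i y x, 0 ≤ (star (φ i) ⬝ᵥ
      ((P.sender.effect x ⊗ₖ (P.receiver x).effect y) *ᵥ φ i)).re := fun i y x =>
    (Complex.le_def.mp ((hpos x y).dotProduct_mulVec_nonneg (φ i))).1
  have hprob : ∀ i y, 0 ≤ P.prob (φ i) y := by
    intro i y
    rw [OneWayProtocol.prob, Complex.re_sum]
    exact Finset.sum_nonneg fun x _ => hnonneg i y x
  have hzero : ∀ i y x, y ≠ label i →
      (P.sender.effect x ⊗ₖ (P.receiver x).effect y) *ᵥ φ i = 0 := by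
    intro i y x hy
    have hy0 : P.prob (φ i) y = 0 := by
      have h1 := htotal i
      rw [← Finset.add_sum_erase _ _ (Finset.mem_univ (label i)), hP i] at h1
      have h2 : ∑ y ∈ Finset.univ.erase (label i), P.prob (φ i) y = 0 := by linarith
      exact (Finset.sum_eq_zero_iff_of_nonneg fun y _ => hprob i y).mp h2 y
        (Finset.mem_erase.mpr ⟨hy, Finset.mem_univ y⟩)
    rw [OneWayProtocol.prob, Complex.re_sum,
      Finset.sum_eq_zero_iff_of_nonneg fun x _ => hnonneg i y x] at hy0
    refine ((hpos x y).dotProduct_mulVec_zero_iff _).mp (Complex.ext (hy0 x (Finset.mem_univ x)) ?_)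
    exact (Complex.le_def.mp ((hpos x y).dotProduct_mulVec_nonneg (φ i))).2.symm
  obtain ⟨x, hx⟩ : ∃ x, P.sender.effect x ≠ 0 := by
    by_contra! h
    have h1 := P.sender.sum_eq_one
    simp only [h, Finset.sum_const_zero] at h1
    exact zero_ne_one h1
  obtain ⟨r, hr⟩ : ∃ r, P.sender.effect x r ≠ 0 := by
    by_contra! h
    exact hx (funext h)
  -- A nonzero row of the effect replaces the usual square root: row `r` of `hzero` says that the
  -- receiver's wrong effects kill the contracted state.
  refine ⟨P.sender.effect x r, hr, fun i j hij => ?_⟩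
  have hann : ∀ i y, y ≠ label i → (P.receiver x).effect y *ᵥ
      ((of fun a c => φ i (a, c))ᵀ *ᵥ P.sender.effect x r) = 0 := by
    intro i y hy
    ext s
    have h := congrFun (hzero i y x hy) (r, s)
    simp only [mulVec, dotProduct, kroneckerMap_apply, Fintype.sum_prod_type, Pi.zero_apply] at h
    simp only [mulVec, dotProduct, transpose_apply, of_apply, Finset.mul_sum, Pi.zero_apply]
    rw [Finset.sum_comm, ← h]
    refine Finset.sum_congr rfl fun a _ => Finset.sum_congr rfl fun c _ => ?_
    ring
  rw [← one_mulVec ((of fun a c => φ j (a, c))ᵀ *ᵥ P.sender.effect x r),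
    ← (P.receiver x).sum_eq_one, Matrix.sum_mulVec, dotProduct_sum]
  refine Finset.sum_eq_zero fun y _ => ?_
  by_cases hy : y = label j
  · have hi : y ≠ label i := fun h => hij (hlabel (h.symm.trans hy))
    rw [dotProduct_mulVec, ← ((P.receiver x).posSemidef y).isHermitian.eq, ← star_mulVec,
      hann i y hi, star_zero, zero_dotProduct]
  · rw [hann j y hy, dotProduct_zero]

/-! ### Pauli strings. -/

/-- The matrices `1, Z, X, ZX` (in terms of the Pauli matrices `X`, `Z`), which are `√2` times the coefficient matrices of the
Bell states. -/
def realPauli : Fin 4 → Matrix (Fin 2) (Fin 2) ℂ :=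
  ![!![1, 0; 0, 1], !![1, 0; 0, -1], !![0, 1; 1, 0], !![0, 1; -1, 0]]

theorem bellState_apply (k : Fin 4) (a c : Fin 2) :
    bellState k (a, c) = ((1 / √2 : ℝ) : ℂ) * realPauli k a c := by
  fin_cases k <;> fin_cases a <;> fin_cases c <;>
    simp [bellState, realPauli, ket]

/-- The two bits of an index are the exponents of `X` and `Z`, which commute up to sign. -/
theorem realPauli_conjTranspose_mul (j k : Fin 4) :
    ∃ s : ℂ, s ≠ 0 ∧ (realPauli j)ᴴ * realPauli k = s • realPauli (j ^^^ k) := by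
  have key : ((realPauli j)ᴴ * realPauli k = (1 : ℂ) • realPauli (j ^^^ k)) ∨
      ((realPauli j)ᴴ * realPauli k = (-1 : ℂ) • realPauli (j ^^^ k)) := by
    fin_cases j <;> fin_cases k <;>
    first
    | (left; ext a c; fin_cases a <;> fin_cases c <;>
        simp [realPauli, Matrix.mul_apply]; done)
    | (right; ext a c; fin_cases a <;> fin_cases c <;>
        simp [realPauli, Matrix.mul_apply])
  rcases key with h | h
  exacts [⟨1, one_ne_zero, h⟩, ⟨-1, neg_ne_zero.mpr one_ne_zero, h⟩]

theorem realPauli_conjTranspose_mul_self (k : Fin 4) : (realPauli k)ᴴ * realPauli k = 1 := by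
  fin_cases k <;> ext a c <;> fin_cases a <;> fin_cases c <;>
    simp [realPauli, Matrix.mul_apply]

theorem realPauli_transpose (k : Fin 4) :
    ∃ s : ℂ, s ≠ 0 ∧ (realPauli k)ᵀ = s • realPauli k := by
  have key : (realPauli k)ᵀ = (1 : ℂ) • realPauli k ∨
      (realPauli k)ᵀ = (-1 : ℂ) • realPauli k := by
    fin_cases k <;>
    first
    | (left; ext a c; fin_cases a <;> fin_cases c <;> simp [realPauli]; done)
    | (right; ext a c; fin_cases a <;> fin_cases c <;> simp [realPauli])
  rcases key with h | h
  exacts [⟨1, one_ne_zero, h⟩, ⟨-1, neg_ne_zero.mpr one_ne_zero, h⟩]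

/-- The tensor product of the matrices `realPauli (f l)`. -/
def pauliString {m : ℕ} (f : Fin m → Fin 4) : Matrix (Fin m → Fin 2) (Fin m → Fin 2) ℂ :=
  Matrix.of fun a c => ∏ l, realPauli (f l) (a l) (c l)

theorem pauliString_conjTranspose_mul_apply {m : ℕ} (f g : Fin m → Fin 4) (a c : Fin m → Fin 2) :
    ((pauliString f)ᴴ * pauliString g) a c =
      ∏ l, ((realPauli (f l))ᴴ * realPauli (g l)) (a l) (c l) := by
  simp only [Matrix.mul_apply, pauliString, Matrix.conjTranspose_apply, Matrix.of_apply, star_prod,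
    ← Finset.prod_mul_distrib]
  rw [Finset.prod_univ_sum, Fintype.piFinset_univ]

theorem pauliString_conjTranspose_mul {m : ℕ} (f g : Fin m → Fin 4) :
    ∃ s : ℂ, s ≠ 0 ∧
      (pauliString f)ᴴ * pauliString g = s • pauliString (fun l => f l ^^^ g l) := by
  choose s hs h using fun l => realPauli_conjTranspose_mul (f l) (g l)
  refine ⟨∏ l, s l, Finset.prod_ne_zero_iff.mpr fun l _ => hs l, ?_⟩
  ext a c
  rw [pauliString_conjTranspose_mul_apply]
  simp [h, pauliString, Finset.prod_mul_distrib]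

theorem pauliString_conjTranspose_mul_self {m : ℕ} (f : Fin m → Fin 4) :
    (pauliString f)ᴴ * pauliString f = 1 := by
  ext a c
  simp only [pauliString_conjTranspose_mul_apply, realPauli_conjTranspose_mul_self,
    Matrix.one_apply, Finset.prod_ite_zero, Finset.mem_univ, true_implies, Finset.prod_const_one,
    funext_iff]

theorem pauliString_transpose {m : ℕ} (f : Fin m → Fin 4) :
    ∃ s : ℂ, s ≠ 0 ∧ (pauliString f)ᵀ = s • pauliString f := by
  choose s hs h using fun l => realPauli_transpose (f l)
  refine ⟨∏ l, s l, Finset.prod_ne_zero_iff.mpr fun l _ => hs l, ?_⟩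
  ext a c
  have h' : ∀ l, realPauli (f l) (c l) (a l) = s l * realPauli (f l) (a l) (c l) := fun l => by
    simpa using congrFun (congrFun (h l) (a l)) (c l)
  simp [pauliString, h', Finset.prod_mul_distrib]

theorem star_mulVec_dotProduct_mulVec {m n : Type} [Fintype m] [Fintype n]
    (A B : Matrix m n ℂ) (v : n → ℂ) :
    star (A *ᵥ v) ⬝ᵥ (B *ᵥ v) = star v ⬝ᵥ ((Aᴴ * B) *ᵥ v) := by
  rw [Matrix.star_mulVec, ← Matrix.dotProduct_mulVec, Matrix.mulVec_mulVec]

/-! ### Sixteen orthogonal vectors. -/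

/-- The differences of three distinct points of `𝔽₂²` are its three nonzero elements. Pairs σ, τ of
opposite parity give the 9 triples with one zero entry and two equal ones; pairs of equal parity
give the 6 orderings of the nonzero elements. -/
theorem exists_perm_xor_perm (b : Fin 3 → Fin 4) (hb : Function.Injective b) (j k : Fin 4)
    (hjk : (j, k) ≠ (0, 0)) :
    ∃ σ τ : Equiv.Perm (Fin 3), σ ≠ τ ∧
      (fun l => b (σ l) ^^^ b (τ l)) = ![j, k, j ^^^ k] := by
  revert b j k
  decide +kernel

/-- The sixteen Pauli strings whose labels add up to zero are, up to signs, the products of two of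
the strings `b ∘ σ`. So a vector sent by the latter to orthogonal vectors is sent by the former to
sixteen orthogonal vectors of `ℂ⁸`. -/
theorem eq_zero_of_pauliString_orthogonal (b : Fin 3 → Fin 4) (hb : Function.Injective b)
    (v : (Fin 3 → Fin 2) → ℂ)
    (hv : ∀ σ τ : Equiv.Perm (Fin 3), σ ≠ τ →
      star (pauliString (b ∘ σ) *ᵥ v) ⬝ᵥ (pauliString (b ∘ τ) *ᵥ v) = 0) :
    v = 0 := by
  by_contra hv0
  let g : Fin 4 × Fin 4 → Fin 3 → Fin 4 := fun p => ![p.1, p.2, p.1 ^^^ p.2]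
  have hexp : ∀ p, p ≠ (0, 0) → star v ⬝ᵥ (pauliString (g p) *ᵥ v) = 0 := by
    rintro ⟨j, k⟩ hp
    obtain ⟨σ, τ, hστ, h⟩ := exists_perm_xor_perm b hb j k hp
    obtain ⟨s, hs, hmul⟩ := pauliString_conjTranspose_mul (b ∘ σ) (b ∘ τ)
    have := hv σ τ hστ
    rw [star_mulVec_dotProduct_mulVec, hmul, Matrix.smul_mulVec, dotProduct_smul,
      smul_eq_mul] at this
    have h0 := (mul_eq_zero.mp this).resolve_left hs
    simp only [Function.comp_apply, h] at h0
    exact h0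
  have hxor : ∀ p q, (fun l => g p l ^^^ g q l) = g (p.1 ^^^ q.1, p.2 ^^^ q.2) := by
    rintro ⟨j, k⟩ ⟨j', k'⟩
    funext l
    fin_cases l
    · rfl
    · rfl
    · revert j k j' k'
      decide
  have hne : ∀ p q : Fin 4 × Fin 4, p ≠ q → (p.1 ^^^ q.1, p.2 ^^^ q.2) ≠ (0, 0) := by
    decide
  have hli : LinearIndependent ℂ fun p => WithLp.toLp 2 (pauliString (g p) *ᵥ v) := by
    refine linearIndependent_of_ne_zero_of_inner_eq_zero (𝕜 := ℂ) (fun p h => hv0 ?_)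
      fun p q hpq => ?_
    · have h' : pauliString (g p) *ᵥ v = 0 := congrArg WithLp.ofLp h
      rw [← Matrix.one_mulVec v, ← pauliString_conjTranspose_mul_self (g p),
        ← Matrix.mulVec_mulVec, h', Matrix.mulVec_zero]
    · obtain ⟨s, -, hmul⟩ := pauliString_conjTranspose_mul (g p) (g q)
      rw [EuclideanSpace.inner_toLp_toLp, dotProduct_comm, star_mulVec_dotProduct_mulVec, hmul,
        Matrix.smul_mulVec, dotProduct_smul, hxor, hexp _ (hne p q hpq), smul_zero]
  have := hli.fintype_card_le_finrank
  simp at this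

/-! ### Bell states and the conclusion. -/

theorem jointState_bellState_apply {m : ℕ} {K : Type} (b : K → Fin 4) (j : Fin m → K)
    (a c : Fin m → Fin 2) :
    jointState (fun k => bellState (b k)) j (a, c) =
      ((1 / √2 : ℝ) : ℂ) ^ m * pauliString (b ∘ j) a c := by
  simp [jointState, bellState_apply, pauliString, Finset.prod_mul_distrib]

theorem ofReal_one_div_sqrt_two_pow_three :
    ((1 / √2 : ℝ) : ℂ) ^ 3 = ((1 / √(Fintype.card (Fin 3 → Fin 2) : ℝ) : ℝ) : ℂ) := by
  rw [← Complex.ofReal_pow, div_pow, one_pow]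
  congr 2
  rw [eq_comm, Real.sqrt_eq_iff_mul_self_eq (by positivity) (by positivity), eq_comm]
  have h : √2 * √2 = 2 := Real.mul_self_sqrt (by norm_num)
  calc √2 ^ 3 * √2 ^ 3 = (√2 * √2) ^ 3 := by ring
    _ = _ := by rw [h]; norm_num

theorem jointState_bellState_eq_kronecker_mulVec (b : Fin 3 → Fin 4) (σ : Fin 3 → Fin 3) :
    jointState (fun k => bellState (b k)) σ =
      (pauliString (b ∘ σ) ⊗ₖ (1 : Matrix (Fin 3 → Fin 2) (Fin 3 → Fin 2) ℂ)) *ᵥ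
        maxEntangled (Fin 3 → Fin 2) := by
  ext ⟨a, c⟩
  rw [jointState_bellState_apply, ofReal_one_div_sqrt_two_pow_three]
  simp only [Matrix.mulVec, dotProduct, Matrix.kroneckerMap_apply, Fintype.sum_prod_type,
    maxEntangled, Matrix.one_apply, mul_ite, mul_one, mul_zero, ite_mul, zero_mul]
  simp [mul_comm]

theorem star_jointState_bellState_dotProduct_self (b : Fin 3 → Fin 4) (σ : Fin 3 → Fin 3) :
    star (jointState (fun k => bellState (b k)) σ) ⬝ᵥ
      jointState (fun k => bellState (b k)) σ = 1 := by
  rw [jointState_bellState_eq_kronecker_mulVec, star_mulVec_dotProduct_mulVec,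
    Matrix.conjTranspose_kronecker, ← Matrix.mul_kronecker_mul, pauliString_conjTranspose_mul_self,
    Matrix.conjTranspose_one, Matrix.one_mul, Matrix.one_kronecker_one, Matrix.one_mulVec]
  simp only [dotProduct, Fintype.sum_prod_type, maxEntangled, Pi.star_apply]
  simp only [RCLike.star_def, apply_ite (starRingEnd ℂ), Complex.conj_ofReal, map_zero, mul_ite,
    ite_mul, zero_mul, mul_zero, Finset.sum_ite_eq, Finset.mem_univ, if_true, ← Complex.ofReal_mul,
    Finset.sum_const, nsmul_eq_mul]
  rw [div_mul_div_comm, one_mul, Real.mul_self_sqrt (Nat.cast_nonneg _), Finset.card_univ]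
  norm_num

theorem not_oneWayIdentifies_jointState_bellState {Y : Type} [Fintype Y]
    (b : Fin 3 → Fin 4) (hb : Function.Injective b) {label : Equiv.Perm (Fin 3) → Y}
    (hlabel : Function.Injective label) :
    ¬ OneWayIdentifies
      (fun σ : Equiv.Perm (Fin 3) => jointState (fun k => bellState (b k)) σ) label := by
  have hscale : ((1 / √2 : ℝ) : ℂ) ^ 3 ≠ 0 := by
    have : (1 / √2 : ℝ) ≠ 0 := by positivity
    exact pow_ne_zero _ (by exact_mod_cast this)
  have hnorm := fun σ : Equiv.Perm (Fin 3) => star_jointState_bellState_dotProduct_self b σ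
  rintro (⟨P, hP⟩ | ⟨P, hP⟩)
  · obtain ⟨v, hv0, hv⟩ := P.exists_orthogonal_of_prob_eq_one hlabel hnorm hP
    refine hv0 (eq_zero_of_pauliString_orthogonal b hb v fun σ τ hστ => ?_)
    -- From Alice to Bob the strings appear transposed, which costs only a sign.
    have hT : ∀ σ : Equiv.Perm (Fin 3), ∃ s : ℂ, s ≠ 0 ∧ (Matrix.of fun a c =>
        jointState (fun k => bellState (b k)) σ (a, c))ᵀ = s • pauliString (b ∘ σ) := by
      intro σ
      obtain ⟨s, hs, h⟩ := pauliString_transpose (b ∘ σ)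
      refine ⟨((1 / √2 : ℝ) : ℂ) ^ 3 * s, mul_ne_zero hscale hs, ?_⟩
      rw [mul_smul, ← h]
      ext a c
      simp only [Matrix.transpose_apply, Matrix.of_apply, jointState_bellState_apply,
        Matrix.smul_apply, smul_eq_mul]
    obtain ⟨s, hs, hsσ⟩ := hT σ
    obtain ⟨t, ht, htτ⟩ := hT τ
    have h := hv σ τ hστ
    rw [hsσ, htτ] at h
    simpa [Matrix.smul_mulVec, hs, ht] using h
  · obtain ⟨v, hv0, hv⟩ := P.exists_orthogonal_of_prob_eq_one hlabel (fun σ => by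
      rw [← hnorm σ]
      exact (Equiv.prodComm _ _).sum_comp fun p =>
        star (jointState (fun k => bellState (b k)) σ) p *
          jointState (fun k => bellState (b k)) σ p) hP
    refine hv0 (eq_zero_of_pauliString_orthogonal b hb v fun σ τ hστ => ?_)
    -- Here the swap of parties cancels the transpose.
    have hT : ∀ σ : Equiv.Perm (Fin 3), (Matrix.of fun a c =>
        (jointState (fun k => bellState (b k)) σ ∘ Prod.swap) (a, c))ᵀ =
          ((1 / √2 : ℝ) : ℂ) ^ 3 • pauliString (b ∘ σ) := by
      intro σ
      ext a c
      simp only [Matrix.transpose_apply, Matrix.of_apply, Function.comp_apply, Prod.swap_prod_mk,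
        jointState_bellState_apply, Matrix.smul_apply, smul_eq_mul]
    have h := hv σ τ hστ
    rw [hT σ, hT τ, Matrix.smul_mulVec, Matrix.smul_mulVec, star_smul, smul_dotProduct,
      dotProduct_smul] at h
    exact (smul_eq_zero.mp ((smul_eq_zero.mp h).resolve_left
      (star_ne_zero.mpr hscale))).resolve_left hscale

theorem proposition4 (b : Fin 3 → Fin 4) (hb : Function.Injective b) :
    ¬ OneWayMarkable 3 (fun k => bellState (b k)) ∧
    ¬ OneWayDistinguishable
        (fun σ : Equiv.Perm (Fin 3) => jointState (fun k => bellState (b k)) σ) ∧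
    ∃ U : Equiv.Perm (Fin 3) → Matrix (Fin 3 → Fin 2) (Fin 3 → Fin 2) ℂ,
      (∀ σ, U σ ∈ Matrix.unitaryGroup (Fin 3 → Fin 2) ℂ) ∧
      (∀ σ : Equiv.Perm (Fin 3), jointState (fun k => bellState (b k)) σ =
        (U σ ⊗ₖ (1 : Matrix (Fin 3 → Fin 2) (Fin 3 → Fin 2) ℂ)) *ᵥ
          maxEntangled (Fin 3 → Fin 2)) ∧
      ¬ ∃ ψ : (Fin 3 → Fin 2) → ℂ, ∀ σ τ,
        star (U σ *ᵥ ψ) ⬝ᵥ (U τ *ᵥ ψ) = if σ = τ then 1 else 0 := by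
  refine ⟨fun h => ?_, fun h => ?_, fun σ => pauliString (b ∘ σ), fun σ => ?_, fun σ => ?_, ?_⟩
  · refine not_oneWayIdentifies_jointState_bellState b hb
      (label := fun σ => (σ : Fin 3 → Fin 3)) DFunLike.coe_injective ?_
    rcases h with ⟨P, hP⟩ | ⟨P, hP⟩
    · exact Or.inl ⟨P, fun σ => hP σ.toEmbedding⟩
    · exact Or.inr ⟨P, fun σ => hP σ.toEmbedding⟩
  · exact not_oneWayIdentifies_jointState_bellState b hb Function.injective_id h
  · exact Matrix.mem_unitaryGroup_iff'.mpr (pauliString_conjTranspose_mul_self _)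
  · exact jointState_bellState_eq_kronecker_mulVec b σ
  · rintro ⟨ψ, hψ⟩
    have h0 := eq_zero_of_pauliString_orthogonal b hb ψ fun σ τ hστ =>
      (hψ σ τ).trans (if_neg hστ)
    have h1 := hψ 1 1
    simp [h0] at h1
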